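/- Fix an integer $k\ge 3$. Distinct finite sets $S_1,\dots,S_k$ form a $k$-sunflower if $S_i\cap S_j$ is the same set for all $1\le i<j\le k$. A family of sets is $k$-sunflower-free if no $k$ distinct members of it form a $k$-sunflower. Let $F_k(n)$ be the maximum size of a $k$-sunflower-free family of subsets of $\{1,\dots,n\}$, and define the $k$-sunflower-free capacity $$\mu_k^{\mathrm S}:=\limsup_{n\to\infty}F_k(n)^{1/n}.$$ A set $A\subseteq\{1,\dots,N\}$ is LCM-$k$-free if it contains no distinct $a_1,\dots,a_k$ for which $\operatorname{lcm}(a_i,a_j)$ is the same for all $1\le i<j\le k$. Let $$f_k(N):=\max\Big\{\sum_{a\in A}\frac1a:\ A\subseteq\{1,\dots,N\}\text{ is LCM-}k\text{-free}\Big\}.$$ **Theorem.** For each integer $k\ge 3$, $$\mu_k^{\mathrm S}=2\quad\Longleftrightarrow\quad f_k(N)=(\log N)^{1-o(1)}\ \text{ as } N\to\infty,$$ where the right-hand side means that there is a real sequence $\varepsilon(N)\to 0$ with $f_k(N)=(\log N)^{1-\varepsilon(N)}$ for all sufficiently large $N$. -/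

import Mathlib

open Filter Topology

noncomputable section

namespace SunflowerLCM

/-- The sets `S 0, …, S (k - 1)` form a `k`-sunflower: they are distinct, and any two of them
have the same intersection `Y` (the kernel). -/
def IsSunflower {α : Type*} [DecidableEq α] {k : ℕ} (S : Fin k → Finset α) : Prop :=
  Function.Injective S ∧ ∃ Y : Finset α, ∀ i j : Fin k, i < j → S i ∩ S j = Y

/-- No `k` distinct members of the family `F` form a `k`-sunflower. -/
def SunflowerFree {α : Type*} [DecidableEq α] (k : ℕ) (F : Finset (Finset α)) : Prop :=
  ¬ ∃ S : Fin k → Finset α, (∀ i, S i ∈ F) ∧ IsSunflower S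

/-- `F_k(n)`: the maximum size of a `k`-sunflower-free family of subsets of an `n`-element set. -/
def maxSunflowerFree (k n : ℕ) : ℕ :=
  sSup {m : ℕ | ∃ F : Finset (Finset (Fin n)), SunflowerFree k F ∧ F.card = m}

/-- The Erdős–Szemerédi `k`-sunflower-free capacity `μ_k^S = limsup_{n → ∞} F_k(n)^{1/n}`. -/
def sunflowerCapacity (k : ℕ) : ℝ :=
  limsup (fun n : ℕ => (maxSunflowerFree k n : ℝ) ^ (1 / (n : ℝ))) atTop

/-- The integers `a 0, …, a (k - 1)` form an LCM-`k`-tuple: they are distinct, and any two of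
them have the same least common multiple `L`. -/
def IsLCMTuple {k : ℕ} (a : Fin k → ℕ) : Prop :=
  Function.Injective a ∧ ∃ L : ℕ, ∀ i j : Fin k, i < j → Nat.lcm (a i) (a j) = L

/-- `A` contains no LCM-`k`-tuple. -/
def LCMFree (k : ℕ) (A : Finset ℕ) : Prop :=
  ¬ ∃ a : Fin k → ℕ, (∀ i, a i ∈ A) ∧ IsLCMTuple a

/-- `f_k(N)`: the maximum of `∑_{a ∈ A} 1/a` over the LCM-`k`-free sets `A ⊆ {1, …, N}`. -/
def maxHarmonicSum (k N : ℕ) : ℝ :=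
  sSup {s : ℝ | ∃ A : Finset ℕ, A ⊆ Finset.Icc 1 N ∧ LCMFree k A ∧ ∑ a ∈ A, (1 : ℝ) / a = s}

/-- `f(N) = (log N)^{c - o(1)}` as `N → ∞`. -/
def EqLogPowSubLittleO (f : ℕ → ℝ) (c : ℝ) : Prop :=
  ∃ ε : ℕ → ℝ, Tendsto ε atTop (𝓝 0) ∧
    ∀ᶠ N : ℕ in atTop, f N = Real.log N ^ (c - ε N)

/-- The supremum defining `F_k(n)` is attained. -/
theorem isGreatest_maxSunflowerFree {k : ℕ} (hk : 1 ≤ k) (n : ℕ) :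
    IsGreatest {m : ℕ | ∃ F : Finset (Finset (Fin n)), SunflowerFree k F ∧ F.card = m}
      (maxSunflowerFree k n) := by
  have hfin : {m : ℕ | ∃ F : Finset (Finset (Fin n)), SunflowerFree k F ∧ F.card = m}.Finite :=
    (Set.finite_range fun F : Finset (Finset (Fin n)) => F.card).subset (by
      rintro m ⟨F, -, rfl⟩; exact ⟨F, rfl⟩)
  have hne : {m : ℕ | ∃ F : Finset (Finset (Fin n)), SunflowerFree k F ∧ F.card = m}.Nonempty := by
    refine ⟨0, ∅, ?_, rfl⟩
    rintro ⟨S, hS, -⟩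
    exact absurd (hS ⟨0, hk⟩) (Finset.notMem_empty _)
  exact ⟨Nat.sSup_mem hne hfin.bddAbove, fun m hm => le_csSup hfin.bddAbove hm⟩

/-- The supremum defining `f_k(N)` is attained. -/
theorem isGreatest_maxHarmonicSum {k : ℕ} (hk : 1 ≤ k) (N : ℕ) :
    IsGreatest
      {s : ℝ | ∃ A : Finset ℕ, A ⊆ Finset.Icc 1 N ∧ LCMFree k A ∧ ∑ a ∈ A, (1 : ℝ) / a = s}
      (maxHarmonicSum k N) := by
  have hfin : {s : ℝ | ∃ A : Finset ℕ, A ⊆ Finset.Icc 1 N ∧ LCMFree k A ∧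
      ∑ a ∈ A, (1 : ℝ) / a = s}.Finite :=
    ((Finset.Icc 1 N).powerset.finite_toSet.image fun A : Finset ℕ => ∑ a ∈ A, (1 : ℝ) / a).subset
      (by
        rintro s ⟨A, hA, -, rfl⟩
        exact ⟨A, Finset.mem_coe.2 (Finset.mem_powerset.2 hA), rfl⟩)
  have hne : {s : ℝ | ∃ A : Finset ℕ, A ⊆ Finset.Icc 1 N ∧ LCMFree k A ∧
      ∑ a ∈ A, (1 : ℝ) / a = s}.Nonempty := by
    refine ⟨0, ∅, Finset.empty_subset _, ?_, by simp⟩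
    rintro ⟨a, ha, -⟩
    exact absurd (ha ⟨0, hk⟩) (Finset.notMem_empty _)
  exact ⟨hne.csSup_mem hfin, fun s hs => le_csSup hfin.bddAbove hs⟩

end SunflowerLCM

end

/-! Squarefree integers are finite sets of primes, with lcm as union, and complementation turns
equal pairwise intersections into equal pairwise unions.

If the capacity is below 2, then `exists_exponential_bound` gives F_k(n) ≤ D r^n with r < 2. Take a
random set C of primes containing p with probability p^(-s). Counting members of a union-free family
inside C bounds its weighted size by D E[r^|C|] = D ∏ (1 + (r - 1) p^(-s)) ≤ D ζ(s)^(r - 1)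
(`UnionFree.sum_prod_le`, `LCMFree.sum_squarefree_le`). With s = 1 + 1/log N this is O((log N)^(r -
1)). Square factors cost only a constant, so f_k(N) saves a power of log N.

If the capacity is 2, the point is to pass from many sets to large weight ∑ l^|A| with l small.
Otherwise, averaging over links (`card_eq_sum_link`) would give F_k(n) ≤ (n + 1)(1 - l + w)^n for
some w < 1 + l, an exponential saving. So some union-rigid family on a set M has weight at least
w^|M|, with w as close to 1 + l as desired (`exists_unionRigid`). Replace each point of M by a block
of primes with reciprocal sum about l: products of one prime from each selected block form an
LCM-rigid set of harmonic sum at least w^|M| (`UnionRigid.exists_lcmRigid`). Multiplying J such sets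
on disjoint primes up to y, with J |M| l about log log y, gives harmonic sum about (log y)^(log w /
l), nearly log y. The integers stay below y^(|M| J), so log y = (log N)^(1 - δ) is admissible.

Rigidity, which also covers tuples with repetitions, replaces freeness because it survives links and
coprime products; it comes from restricting to sets of one size. -/

namespace SunflowerLCM

/-! ### Rigid families, links and the weight of a family -/

/-- A `k`-tuple of members of `F`, not necessarily distinct, whose pairwise unions coincide
is constant. -/
def UnionRigid {α : Type*} [DecidableEq α] (k : ℕ) (F : Finset (Finset α)) : Prop :=
  ∀ (S : Fin k → Finset α) (U : Finset α), (∀ i, S i ∈ F) →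
    (∀ i j, i ≠ j → S i ∪ S j = U) → ∀ i j, S i = S j

/-- A `k`-tuple of members of `A`, not necessarily distinct, whose pairwise least common multiples
coincide is constant. -/
def LCMRigid (k : ℕ) (A : Finset ℕ) : Prop :=
  ∀ (a : Fin k → ℕ) (L : ℕ), (∀ i, a i ∈ A) →
    (∀ i j, i ≠ j → Nat.lcm (a i) (a j) = L) → ∀ i j, a i = a j

theorem LCMRigid.lcmFree {k : ℕ} (hk : 2 ≤ k) {A : Finset ℕ} (hA : LCMRigid k A) :
    LCMFree k A := by
  rintro ⟨a, ha, hinj, L, hL⟩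
  have h := hA a L ha (fun i j hij => by
    rcases lt_or_gt_of_ne hij with h | h
    · exact hL i j h
    · rw [Nat.lcm_comm]; exact hL j i h) ⟨0, by omega⟩ ⟨1, by omega⟩
  simpa using hinj h

theorem SunflowerFree.mono {α : Type*} [DecidableEq α] {k : ℕ} {F G : Finset (Finset α)}
    (hG : SunflowerFree k G) (h : F ⊆ G) : SunflowerFree k F := by
  rintro ⟨S, hS, hsun⟩
  exact hG ⟨S, fun i => h (hS i), hsun⟩

/-- The complements of a uniform sunflower-free family form a union-rigid family. -/
theorem SunflowerFree.unionRigid_compl {α : Type*} [DecidableEq α] [Fintype α] {k t : ℕ}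
    {F : Finset (Finset α)} (hF : SunflowerFree k F) (ht : ∀ A ∈ F, A.card = t) :
    UnionRigid k (F.image compl) := by
  intro S U hS hU i₀ j₀
  have hmem : ∀ i, (S i)ᶜ ∈ F := fun i => by
    obtain ⟨A, hA, hAS⟩ := Finset.mem_image.1 (hS i)
    rw [← hAS, compl_compl]; exact hA
  have hint : ∀ i j, i ≠ j → (S i)ᶜ ∩ (S j)ᶜ = Uᶜ := fun i j hij => by
    rw [← Finset.compl_union, hU i j hij]
  by_cases hinj : Function.Injective fun i => (S i)ᶜ
  · exact absurd ⟨_, hmem, hinj, Uᶜ, fun i j hij => hint i j hij.ne⟩ hF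
  -- Two equal members make the kernel equal to that member, so every other member contains it;
  -- uniformity then forces equality.
  · simp only [Function.Injective, not_forall] at hinj
    obtain ⟨i, j, hij, hne⟩ := hinj
    have hY : (S i)ᶜ = Uᶜ := by
      have h := hint i j hne
      rwa [← hij, Finset.inter_self] at h
    have hall : ∀ l, (S l)ᶜ = (S i)ᶜ := fun l => by
      by_cases hl : l = i
      · rw [hl]
      · refine (Finset.eq_of_subset_of_card_le ?_ ?_).symm
        · rw [hY, ← hint l i hl]; exact Finset.inter_subset_left
        · rw [ht _ (hmem l), ht _ (hmem i)]
    exact compl_injective ((hall i₀).trans (hall j₀).symm)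

/-- The link of `B` in a union-rigid family is union-rigid. -/
theorem UnionRigid.link {α : Type*} [DecidableEq α] {k : ℕ} {F : Finset (Finset α)}
    (hF : UnionRigid k F) (B : Finset α) :
    UnionRigid k ((F.filter (B ⊆ ·)).image (· \ B)) := by
  intro S U hS hU i j
  have hS' : ∀ i, S i ∪ B ∈ F ∧ Disjoint (S i) B := fun i => by
    obtain ⟨A, hA, hAS⟩ := Finset.mem_image.1 (hS i)
    rw [Finset.mem_filter] at hA
    rw [← hAS]
    exact ⟨by rw [Finset.sdiff_union_of_subset hA.2]; exact hA.1, Finset.sdiff_disjoint⟩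
  have h := hF (fun i => S i ∪ B) (U ∪ B) (fun i => (hS' i).1) (fun i j hij => by
    rw [← Finset.union_union_distrib_right, hU i j hij]) i j
  rw [← Finset.union_sdiff_cancel_right (hS' i).2, ← Finset.union_sdiff_cancel_right (hS' j).2]
  exact congrArg (· \ B) h

/-- Double counting: a set is a uniformly weighted union of its subsets and their complements. -/
theorem card_eq_sum_link {α : Type*} [DecidableEq α] [Fintype α] (F : Finset (Finset α)) (l : ℝ) :
    (F.card : ℝ) = ∑ B : Finset α, (1 - l) ^ B.card *
      ∑ A ∈ (F.filter (B ⊆ ·)).image (· \ B), l ^ A.card := by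
  have h1 : ∀ B : Finset α, (1 - l) ^ B.card *
      ∑ A ∈ (F.filter (B ⊆ ·)).image (· \ B), l ^ A.card =
      ∑ A ∈ F, if B ⊆ A then (1 - l) ^ B.card * l ^ (A.card - B.card) else 0 := fun B => by
    rw [Finset.sum_image, Finset.mul_sum, Finset.sum_filter]
    · refine Finset.sum_congr rfl fun A _ => ?_
      split_ifs with h
      · rw [Finset.card_sdiff_of_subset h]
      · rfl
    · intro A hA A' hA' h
      simp only [Finset.coe_filter, Set.mem_ofPred_eq] at hA hA'
      have h : A \ B = A' \ B := h
      rw [← Finset.sdiff_union_of_subset hA.2, ← Finset.sdiff_union_of_subset hA'.2, h]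
  rw [Finset.sum_congr rfl fun B _ => h1 B, Finset.sum_comm]
  have h2 : ∀ A ∈ F, ∑ B : Finset α,
      (if B ⊆ A then (1 - l) ^ B.card * l ^ (A.card - B.card) else 0) = 1 := fun A _ => by
    rw [← Finset.sum_filter]
    have : Finset.univ.filter (· ⊆ A) = A.powerset := by ext; simp
    rw [this, Finset.sum_pow_mul_eq_add_pow]; simp
  rw [Finset.sum_congr rfl h2]; simp

/-- If every union-rigid family on a nonempty ground set `M` has `l`-weight below `w ^ #M`, then
sunflower-free families are small. -/
theorem maxSunflowerFree_le_of_weight_lt {k : ℕ} (hk : 1 ≤ k) {l w : ℝ} (hl1 : l ≤ 1)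
    (H : ∀ (n : ℕ) (M : Finset (Fin n)) (F : Finset (Finset (Fin n))), M.Nonempty →
      UnionRigid k F → (∀ A ∈ F, A ⊆ M) → ∑ A ∈ F, l ^ A.card < w ^ M.card) (n : ℕ) :
    (maxSunflowerFree k n : ℝ) ≤ (n + 1) * (1 - l + w) ^ n := by
  obtain ⟨F, hF, hcard⟩ := (isGreatest_maxSunflowerFree hk n).1
  have key : ∀ t, ((F.slice t).card : ℝ) ≤ (1 - l + w) ^ n := fun t => by
    have hr : UnionRigid k ((F.slice t).image compl) :=
      (hF.mono (Finset.slice_subset)).unionRigid_compl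
        (fun A hA => (Finset.mem_slice.1 hA).2)
    have hc : ((F.slice t).card : ℝ) = (((F.slice t).image compl).card : ℝ) := by
      rw [Finset.card_image_of_injective _ compl_injective]
    rw [hc, card_eq_sum_link _ l]
    have hn : n = (Finset.univ : Finset (Fin n)).card := by simp
    conv_rhs => rw [hn]
    rw [← Finset.sum_pow_mul_eq_add_pow, Finset.powerset_univ]
    refine Finset.sum_le_sum fun B _ => mul_le_mul_of_nonneg_left ?_ (pow_nonneg (by linarith) _)
    rw [Finset.card_univ, ← Finset.card_compl]
    have hsub : ∀ A ∈ (((F.slice t).image compl).filter (B ⊆ ·)).image (· \ B), A ⊆ Bᶜ := by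
      intro A hA
      obtain ⟨A', -, rfl⟩ := Finset.mem_image.1 hA
      intro x hx
      simpa using (Finset.mem_sdiff.1 hx).2
    -- The empty ground set is separate: there `{∅}` has weight exactly `w ^ 0`, so no strict bound
    -- can hold.
    rcases Bᶜ.eq_empty_or_nonempty with hB | hB
    · rw [hB] at hsub ⊢
      refine (Finset.sum_le_sum_of_subset_of_nonneg (t := {∅}) (fun A hA => ?_) ?_).trans ?_
      · simpa using hsub A hA
      · intro A hA _
        rw [Finset.mem_singleton.1 hA]; simp
      · simp
    · exact (H n Bᶜ _ hB (hr.link B) hsub).le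
  have h := Finset.sum_card_slice F
  rw [← hcard, ← h]
  push_cast
  refine (Finset.sum_le_sum fun t _ => key t).trans ?_
  simp

/-! ### From an exponential sunflower bound to a power saving for LCM-free sets -/

/-- No `k` distinct members of `F` have the same pairwise unions. -/
def UnionFree {α : Type*} [DecidableEq α] (k : ℕ) (F : Finset (Finset α)) : Prop :=
  ¬ ∃ S : Fin k → Finset α, (∀ i, S i ∈ F) ∧ Function.Injective S ∧
    ∃ U : Finset α, ∀ i j : Fin k, i < j → S i ∪ S j = U

/-- Complementation inside `C` turns equal unions into equal intersections. -/
theorem UnionFree.card_le {α : Type*} [DecidableEq α] {k : ℕ} (hk : 1 ≤ k)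
    {F : Finset (Finset α)} (hF : UnionFree k F) (C : Finset α) :
    (F.filter (· ⊆ C)).card ≤ maxSunflowerFree k C.card := by
  let e : Fin C.card ↪ α := C.equivFin.symm.toEmbedding.trans (Function.Embedding.subtype _)
  let φ : Finset α → Finset (Fin C.card) := fun S => Finset.univ.filter fun i => e i ∉ S
  let ψ : Finset (Fin C.card) → Finset α := fun T => Tᶜ.map e
  have hψφ : ∀ S ⊆ C, ψ (φ S) = S := fun S hS => by
    ext x
    simp only [ψ, φ, Finset.mem_map, Finset.mem_compl, Finset.mem_filter, Finset.mem_univ,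
      true_and, not_not]
    constructor
    · rintro ⟨i, hi, rfl⟩; exact hi
    · intro hx
      have hex : e (C.equivFin ⟨x, hS hx⟩) = x := by simp [e]
      exact ⟨C.equivFin ⟨x, hS hx⟩, by rwa [hex], hex⟩
  have hinj : Set.InjOn φ (F.filter (· ⊆ C)) := fun S hS T hT h => by
    rw [← hψφ S (Finset.mem_filter.1 hS).2, ← hψφ T (Finset.mem_filter.1 hT).2, h]
  rw [← Finset.card_image_of_injOn hinj]
  refine (isGreatest_maxSunflowerFree hk C.card).2 ⟨_, ?_, rfl⟩
  rintro ⟨T, hT, hTinj, Y, hY⟩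
  have hT' : ∀ i, ψ (T i) ∈ F ∧ φ (ψ (T i)) = T i := fun i => by
    obtain ⟨S, hS, hST⟩ := Finset.mem_image.1 (hT i)
    rw [Finset.mem_filter] at hS
    rw [← hST, hψφ S hS.2]
    exact ⟨hS.1, rfl⟩
  refine hF ⟨fun i => ψ (T i), fun i => (hT' i).1, fun i j hij => hTinj ?_, ψ Y,
    fun i j hij => ?_⟩
  · rw [← (hT' i).2, ← (hT' j).2]; exact congrArg φ hij
  · simp only [ψ]
    rw [← Finset.map_union, ← Finset.compl_inter, hY i j hij]

/-- A random subset of `P` containing each `p` independently with probability `w p` contains `S`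
with probability `∏ p ∈ S, w p`. -/
theorem sum_powerset_superset_prod {α : Type*} [DecidableEq α] {P S : Finset α} (hS : S ⊆ P)
    (w : α → ℝ) :
    ∑ C ∈ P.powerset, (if S ⊆ C then (∏ p ∈ C, w p) * ∏ p ∈ P \ C, (1 - w p) else 0) =
      ∏ p ∈ S, w p := by
  -- The factor is `w p` on `S` and 1 off `S`; in the expansion, the zero summand kills every `C`
  -- that misses a point of `S`.
  have h := Finset.prod_add w (fun p => if p ∈ S then 0 else 1 - w p) P
  have h1 : ∏ p ∈ P, (w p + if p ∈ S then 0 else 1 - w p) = ∏ p ∈ S, w p := by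
    rw [← Finset.prod_subset hS fun p _ hp => by simp [hp]]
    exact Finset.prod_congr rfl fun p hp => by simp [hp]
  rw [← h1, h]
  refine Finset.sum_congr rfl fun C hC => ?_
  split_ifs with hSC
  · congr 1
    refine Finset.prod_congr rfl fun p hp => ?_
    rw [if_neg fun hpS => (Finset.mem_sdiff.1 hp).2 (hSC hpS)]
  · obtain ⟨p, hpS, hpC⟩ := Finset.not_subset.1 hSC
    rw [Finset.prod_eq_zero (i := p) (Finset.mem_sdiff.2 ⟨hS hpS, hpC⟩) (by simp [hpS]), mul_zero]

/-- Both sides are expectations over a random `C ⊆ P`: the left is the expected number of members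
inside `C`, the right is `D` times the expectation of `r ^ #C`. -/
theorem UnionFree.sum_prod_le {α : Type*} [DecidableEq α] {k : ℕ} (hk : 1 ≤ k) {D r : ℝ}
    (hD : ∀ n, (maxSunflowerFree k n : ℝ) ≤ D * r ^ n) {P : Finset α} {w : α → ℝ}
    (hw0 : ∀ p ∈ P, 0 ≤ w p) (hw1 : ∀ p ∈ P, w p ≤ 1) {F : Finset (Finset α)}
    (hF : UnionFree k F) (hP : ∀ S ∈ F, S ⊆ P) :
    ∑ S ∈ F, ∏ p ∈ S, w p ≤ D * ∏ p ∈ P, (1 + (r - 1) * w p) := by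
  have h1 : ∑ S ∈ F, ∏ p ∈ S, w p = ∑ C ∈ P.powerset,
      ((F.filter (· ⊆ C)).card : ℝ) * ((∏ p ∈ C, w p) * ∏ p ∈ P \ C, (1 - w p)) := by
    rw [Finset.sum_congr rfl fun S hS => (sum_powerset_superset_prod (hP S hS) w).symm,
      Finset.sum_comm]
    refine Finset.sum_congr rfl fun C _ => ?_
    rw [← Finset.sum_filter, Finset.sum_const, nsmul_eq_mul]
  have h2 : ∏ p ∈ P, (1 + (r - 1) * w p) = ∑ C ∈ P.powerset,
      r ^ C.card * ((∏ p ∈ C, w p) * ∏ p ∈ P \ C, (1 - w p)) := by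
    rw [Finset.prod_congr rfl fun p _ =>
      (by ring : 1 + (r - 1) * w p = r * w p + (1 - w p)), Finset.prod_add]
    refine Finset.sum_congr rfl fun C _ => ?_
    rw [Finset.prod_mul_distrib, Finset.prod_const, mul_assoc]
  rw [h1, h2, Finset.mul_sum]
  refine Finset.sum_le_sum fun C hC => ?_
  rw [← mul_assoc D]
  refine mul_le_mul_of_nonneg_right
    ((Nat.cast_le.2 (hF.card_le hk C)).trans (hD _)) (mul_nonneg ?_ ?_)
  · exact Finset.prod_nonneg fun p hp => hw0 p (Finset.mem_powerset.1 hC hp)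
  · exact Finset.prod_nonneg fun p hp => sub_nonneg.2 (hw1 p (Finset.mem_sdiff.1 hp).1)

theorem LCMFree.unionFree_primeFactors {k : ℕ} {A : Finset ℕ} (hA : LCMFree k A)
    (hsq : ∀ a ∈ A, Squarefree a) : UnionFree k (A.image Nat.primeFactors) := by
  rintro ⟨S, hS, hinj, U, hU⟩
  have hS' : ∀ i, ∃ a ∈ A, a.primeFactors = S i := fun i => Finset.mem_image.1 (hS i)
  choose a ha haS using hS'
  refine hA ⟨a, ha, fun i j hij => hinj ?_, ∏ p ∈ U, p, fun i j hij => ?_⟩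
  · rw [← haS i, ← haS j, hij]
  · have h0 : ∀ i, a i ≠ 0 := fun i => (hsq _ (ha i)).ne_zero
    have hl : Squarefree (Nat.lcm (a i) (a j)) := by
      rw [Nat.squarefree_iff_factorization_le_one (Nat.lcm_ne_zero (h0 i) (h0 j))]
      intro p
      rw [Nat.factorization_lcm (h0 i) (h0 j), Finsupp.sup_apply]
      exact max_le ((hsq _ (ha i)).natFactorization_le_one p)
        ((hsq _ (ha j)).natFactorization_le_one p)
    rw [← Nat.prod_primeFactors_of_squarefree hl, ← hU i j hij, ← haS i, ← haS j]
    congr 1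
    ext p
    simp only [Nat.mem_primeFactors, Finset.mem_union]
    constructor
    · rintro ⟨hp, hd, -⟩
      rcases (hp.dvd_lcm).1 hd with h | h
      · exact Or.inl ⟨hp, h, h0 i⟩
      · exact Or.inr ⟨hp, h, h0 j⟩
    · rintro (⟨hp, hd, -⟩ | ⟨hp, hd, -⟩)
      · exact ⟨hp, hd.trans (Nat.dvd_lcm_left _ _), Nat.lcm_ne_zero (h0 i) (h0 j)⟩
      · exact ⟨hp, hd.trans (Nat.dvd_lcm_right _ _), Nat.lcm_ne_zero (h0 i) (h0 j)⟩

/-- Compares each factor of the random-subset bound with a power of an Euler factor. -/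
theorem one_add_mul_le_inv_rpow {c x : ℝ} (hc : 0 ≤ c) (hx1 : x < 1) :
    1 + c * x ≤ ((1 - x)⁻¹) ^ c := by
  have h : 0 < (1 - x)⁻¹ := inv_pos.2 (by linarith)
  rw [Real.rpow_def_of_pos h, Real.log_inv]
  have h1 := Real.log_le_sub_one_of_pos (sub_pos.2 hx1)
  have h2 := Real.add_one_le_exp (-Real.log (1 - x) * c)
  nlinarith

/-- The Euler product over finitely many primes is at most the zeta sum. -/
theorem prod_inv_one_sub_rpow_le {s : ℝ} (hs : 1 < s) (N : ℕ) :
    ∏ p ∈ N.primesBelow, (1 - (p : ℝ) ^ (-s))⁻¹ ≤ ∑' n : ℕ, 1 / (n : ℝ) ^ s := by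
  let f : ℕ →* ℝ :=
    { toFun := fun n => (n : ℝ) ^ (-s)
      map_one' := by simp
      map_mul' := fun a b => by
        push_cast; exact Real.mul_rpow (Nat.cast_nonneg _) (Nat.cast_nonneg _) }
  have hf : ∀ n : ℕ, f n = 1 / (n : ℝ) ^ s := fun n => by
    change (n : ℝ) ^ (-s) = _
    rw [Real.rpow_neg (Nat.cast_nonneg _), one_div]
  have hsum : Summable f := by
    refine (Real.summable_one_div_nat_rpow.2 hs).congr fun n => ?_
    exact (hf n).symm
  have h := EulerProduct.prod_primesBelow_geometric_eq_tsum_smoothNumbers hsum N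
  change ∏ p ∈ N.primesBelow, (1 - f p)⁻¹ ≤ _
  rw [h, ← tsum_congr hf]
  exact hsum.tsum_subtype_le _ _ (fun n => Real.rpow_nonneg (Nat.cast_nonneg _) _)

/-- The random-subset bound with weights `p ^ (-s)`, whose product over the prime factors of a
squarefree `v` is `v ^ (-s)`. -/
theorem LCMFree.sum_squarefree_le {k : ℕ} (hk : 1 ≤ k) {D r : ℝ} (hD0 : 0 ≤ D) (hr : 1 ≤ r)
    (hD : ∀ n, (maxSunflowerFree k n : ℝ) ≤ D * r ^ n) {N : ℕ} {V : Finset ℕ}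
    (hV : LCMFree k V) (hVN : V ⊆ Finset.Icc 1 N) (hsq : ∀ v ∈ V, Squarefree v)
    {s : ℝ} (hs : 1 < s) :
    ∑ v ∈ V, (v : ℝ) ^ (-s) ≤ D * (∑' n : ℕ, 1 / (n : ℝ) ^ s) ^ (r - 1) := by
  have hw : ∀ p ∈ (N + 1).primesBelow, 0 ≤ (p : ℝ) ^ (-s) ∧ (p : ℝ) ^ (-s) < 1 := fun p hp => by
    refine ⟨Real.rpow_nonneg (Nat.cast_nonneg _) _,
      Real.rpow_lt_one_of_one_lt_of_neg ?_ (by linarith)⟩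
    exact_mod_cast (Nat.prime_of_mem_primesBelow hp).one_lt
  have h := (hV.unionFree_primeFactors hsq).sum_prod_le hk hD
    (P := (N + 1).primesBelow) (w := fun p => (p : ℝ) ^ (-s))
    (fun p hp => (hw p hp).1) (fun p hp => (hw p hp).2.le) (by
      intro S hS p hp
      obtain ⟨v, hv, rfl⟩ := Finset.mem_image.1 hS
      rw [Nat.mem_primeFactors] at hp
      have h1 := Nat.le_of_dvd (Nat.pos_of_ne_zero hp.2.2) hp.2.1
      have h2 := (Finset.mem_Icc.1 (hVN hv)).2
      exact Nat.mem_primesBelow.2 ⟨by omega, hp.1⟩)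
  rw [Finset.sum_image] at h
  · refine le_trans (le_of_eq ?_) (h.trans (mul_le_mul_of_nonneg_left ?_ hD0))
    · refine Finset.sum_congr rfl fun v hv => ?_
      rw [Real.finsetProd_rpow _ _ fun _ _ => Nat.cast_nonneg _, ← Nat.cast_prod,
        Nat.prod_primeFactors_of_squarefree (hsq v hv)]
    · have hinv : ∀ p ∈ (N + 1).primesBelow, 0 ≤ (1 - (p : ℝ) ^ (-s))⁻¹ := fun p hp =>
        inv_nonneg.2 (sub_nonneg.2 (hw p hp).2.le)
      calc ∏ p ∈ (N + 1).primesBelow, (1 + (r - 1) * (p : ℝ) ^ (-s))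
          ≤ ∏ p ∈ (N + 1).primesBelow, ((1 - (p : ℝ) ^ (-s))⁻¹) ^ (r - 1) := by
            refine Finset.prod_le_prod (fun p hp => ?_) fun p hp =>
              one_add_mul_le_inv_rpow (sub_nonneg.2 hr) (hw p hp).2
            have := mul_nonneg (sub_nonneg.2 hr) (hw p hp).1
            linarith
        _ = (∏ p ∈ (N + 1).primesBelow, (1 - (p : ℝ) ^ (-s))⁻¹) ^ (r - 1) :=
            Real.finsetProd_rpow _ _ hinv _
        _ ≤ _ := Real.rpow_le_rpow (Finset.prod_nonneg hinv)
            (prod_inv_one_sub_rpow_le hs _) (sub_nonneg.2 hr)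
  · intro a ha b hb hab
    rw [← Nat.prod_primeFactors_of_squarefree (hsq a ha),
      ← Nat.prod_primeFactors_of_squarefree (hsq b hb), hab]

/-- Rankin's trick: `v ^ (1 / log N) ≤ e` for `v ≤ N`. -/
theorem one_div_le_exp_one_mul_rpow {N v : ℕ} (hN : 2 ≤ N) (hv1 : 1 ≤ v) (hv : v ≤ N) :
    1 / (v : ℝ) ≤ Real.exp 1 * (v : ℝ) ^ (-(1 + 1 / Real.log N)) := by
  have hv0 : (0 : ℝ) < v := by exact_mod_cast hv1
  have hlN : 0 < Real.log N := Real.log_pos (by exact_mod_cast hN)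
  have hlv : Real.log v ≤ Real.log N := Real.log_le_log hv0 (by exact_mod_cast hv)
  rw [one_div, Real.rpow_def_of_pos hv0, ← Real.exp_add]
  conv_lhs => rw [← Real.exp_log hv0, ← Real.exp_neg]
  rw [Real.exp_le_exp]
  have : Real.log v * (1 / Real.log N) ≤ 1 := by
    rw [mul_one_div]; exact (div_le_one hlN).2 hlv
  linarith

/-- Write each integer as `b ^ 2 * v` with `v` squarefree. For fixed `b` the values `v` are again
LCM-free, since lcm commutes with scaling, and the factors `1 / b ^ 2` are summable. -/
theorem LCMFree.sum_le {k : ℕ} (hk : 1 ≤ k) {D r : ℝ} (hD0 : 0 ≤ D) (hr : 1 ≤ r)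
    (hD : ∀ n, (maxSunflowerFree k n : ℝ) ≤ D * r ^ n) {N : ℕ} (hN : 2 ≤ N) {A : Finset ℕ}
    (hA : LCMFree k A) (hAN : A ⊆ Finset.Icc 1 N) :
    ∑ a ∈ A, (1 : ℝ) / a ≤ (∑' n : ℕ, 1 / (n : ℝ) ^ 2) * (Real.exp 1 *
      (D * (∑' n : ℕ, 1 / (n : ℝ) ^ (1 + 1 / Real.log N)) ^ (r - 1))) := by
  have hlN : 0 < Real.log N := Real.log_pos (by exact_mod_cast hN)
  have hs : 1 < 1 + 1 / Real.log N := by have := one_div_pos.2 hlN; linarith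
  set K : ℝ := Real.exp 1 * (D * (∑' n : ℕ, 1 / (n : ℝ) ^ (1 + 1 / Real.log N)) ^ (r - 1))
    with hK
  have hK0 : 0 ≤ K := by
    have : 0 ≤ ∑' n : ℕ, 1 / (n : ℝ) ^ (1 + 1 / Real.log N) := tsum_nonneg fun n => by positivity
    positivity
  have hdec : ∀ n : ℕ, ∃ v b : ℕ, b ^ 2 * v = n ∧ Squarefree v := Nat.sq_mul_squarefree
  choose v b hvb hsq using hdec
  have hpos : ∀ a ∈ A, 1 ≤ v a ∧ v a ≤ N ∧ 1 ≤ b a := fun a ha => by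
    obtain ⟨h1, h2⟩ := Finset.mem_Icc.1 (hAN ha)
    have hb : b a ≠ 0 := fun h => by
      have := hvb a; rw [h] at this; simp at this; omega
    refine ⟨(hsq a).ne_zero.bot_lt, ?_, hb.bot_lt⟩
    calc v a ≤ b a ^ 2 * v a := Nat.le_mul_of_pos_left _ (by positivity)
      _ ≤ N := by rw [hvb]; exact h2
  have hfib : ∀ c : ℕ, ∑ a ∈ A with b a = c, (1 : ℝ) / a ≤ 1 / (c : ℝ) ^ 2 * K := fun c => by
    have hinj : Set.InjOn v (A.filter (b · = c)) := fun x hx y hy hxy => by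
      rw [← hvb x, ← hvb y, (Finset.mem_filter.1 hx).2, (Finset.mem_filter.1 hy).2, hxy]
    have hV : LCMFree k ((A.filter (b · = c)).image v) := by
      rintro ⟨a, ha, hai, L, hL⟩
      have ha' : ∀ i, c ^ 2 * a i ∈ A ∧ 0 < c := fun i => by
        obtain ⟨x, hx, hxa⟩ := Finset.mem_image.1 (ha i)
        rw [Finset.mem_filter] at hx
        rw [← hxa, ← hx.2, hvb]
        exact ⟨hx.1, (hpos x hx.1).2.2⟩
      refine hA ⟨fun i => c ^ 2 * a i, fun i => (ha' i).1, fun i j hij => hai ?_, c ^ 2 * L,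
        fun i j hij => ?_⟩
      · have := (ha' i).2
        exact Nat.eq_of_mul_eq_mul_left (by positivity) hij
      · rw [Nat.lcm_mul_left, hL i j hij]
    have hVN : (A.filter (b · = c)).image v ⊆ Finset.Icc 1 N := fun y hy => by
      obtain ⟨x, hx, rfl⟩ := Finset.mem_image.1 hy
      obtain ⟨h1, h2, -⟩ := hpos x (Finset.mem_filter.1 hx).1
      exact Finset.mem_Icc.2 ⟨h1, h2⟩
    have h := hV.sum_squarefree_le hk hD0 hr hD hVN (fun y hy => by
      obtain ⟨x, -, rfl⟩ := Finset.mem_image.1 hy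
      exact hsq x) hs
    calc ∑ a ∈ A with b a = c, (1 : ℝ) / a
        = 1 / (c : ℝ) ^ 2 * ∑ y ∈ (A.filter (b · = c)).image v, (1 : ℝ) / y := by
          rw [Finset.sum_image hinj, Finset.mul_sum]
          refine Finset.sum_congr rfl fun x hx => ?_
          conv_lhs => rw [← hvb x, (Finset.mem_filter.1 hx).2]
          push_cast
          rw [one_div_mul_one_div]
      _ ≤ 1 / (c : ℝ) ^ 2 * K := by
          refine mul_le_mul_of_nonneg_left ?_ (by positivity)
          refine (Finset.sum_le_sum fun y hy => one_div_le_exp_one_mul_rpow hN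
            (Finset.mem_Icc.1 (hVN hy)).1 (Finset.mem_Icc.1 (hVN hy)).2).trans ?_
          rw [← Finset.mul_sum]
          exact mul_le_mul_of_nonneg_left h (Real.exp_nonneg _)
  calc ∑ a ∈ A, (1 : ℝ) / a = ∑ c ∈ A.image b, ∑ a ∈ A with b a = c, (1 : ℝ) / a :=
        (Finset.sum_fiberwise_of_maps_to (fun a ha => Finset.mem_image_of_mem b ha) _).symm
    _ ≤ ∑ c ∈ A.image b, 1 / (c : ℝ) ^ 2 * K := Finset.sum_le_sum fun c _ => hfib c
    _ = (∑ c ∈ A.image b, 1 / (c : ℝ) ^ 2) * K := (Finset.sum_mul ..).symm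
    _ ≤ _ := mul_le_mul_of_nonneg_right ((Real.summable_one_div_nat_pow.2 one_lt_two).sum_le_tsum
        _ fun _ _ => by positivity) hK0

/-- An exponential saving for sunflower-free families yields a power saving for LCM-free sets. -/
theorem exists_maxHarmonicSum_le {k : ℕ} (hk : 1 ≤ k) {D r : ℝ} (hD0 : 0 ≤ D) (hr : 1 ≤ r)
    (hD : ∀ n, (maxSunflowerFree k n : ℝ) ≤ D * r ^ n) :
    ∃ K : ℝ, ∀ᶠ N : ℕ in atTop, maxHarmonicSum k N ≤ K * Real.log N ^ (r - 1) := by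
  have hZ0 : 0 ≤ ∑' n : ℕ, 1 / (n : ℝ) ^ 2 := tsum_nonneg fun n => by positivity
  refine ⟨(∑' n : ℕ, 1 / (n : ℝ) ^ 2) * (Real.exp 1 * (D * 2 ^ (r - 1))), ?_⟩
  have hlog : Tendsto (fun N : ℕ => Real.log N) atTop atTop :=
    Real.tendsto_log_atTop.comp tendsto_natCast_atTop_atTop
  have hσ : Tendsto (fun N : ℕ => 1 + 1 / Real.log N) atTop (𝓝[>] 1) := by
    rw [tendsto_nhdsWithin_iff]
    constructor
    · simpa using (tendsto_inv_atTop_zero.comp hlog).const_add 1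
    · filter_upwards [hlog.eventually_gt_atTop 0] with N hN
      have := one_div_pos.2 hN
      simpa using hN
  -- Since (s - 1) ζ(s) tends to 1 as s decreases to 1, the zeta sum is eventually at most `2 * log
  -- N`.
  have hlim := (tendsto_sub_mul_tsum_nat_rpow.comp hσ).eventually_le_const
    (show (1 : ℝ) < 2 by norm_num)
  filter_upwards [hlim, eventually_ge_atTop 2] with N hN hN2
  have hlN : 0 < Real.log N := Real.log_pos (by exact_mod_cast hN2)
  obtain ⟨A, hAN, hA, hsum⟩ := (isGreatest_maxHarmonicSum hk N).1
  rw [← hsum]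
  refine (hA.sum_le hk hD0 hr hD hN2 hAN).trans ?_
  set T := ∑' n : ℕ, 1 / (n : ℝ) ^ (1 + 1 / Real.log N) with hT
  have hT0 : 0 ≤ T := tsum_nonneg fun n => by positivity
  have hT2 : T ≤ 2 * Real.log N := by
    have h : (1 + 1 / Real.log N - 1) * T ≤ 2 := hN
    rw [add_sub_cancel_left, one_div_mul_eq_div, div_le_iff₀ hlN] at h
    exact h
  have h := Real.rpow_le_rpow hT0 hT2 (sub_nonneg.2 hr)
  rw [Real.mul_rpow (by norm_num) hlN.le] at h
  have hp : 0 ≤ Real.log N ^ (r - 1) := Real.rpow_nonneg hlN.le _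
  have h' := mul_le_mul_of_nonneg_left h
    (mul_nonneg hZ0 (mul_nonneg (Real.exp_nonneg 1) hD0))
  linarith

/-! ### LCM-rigid sets from blocks of primes -/

/-- Greedy choice: the first element to bring the total up to `l` overshoots by at most `η`. -/
theorem exists_subset_sum_mem_Icc {α : Type*} [DecidableEq α] {x : α → ℝ} {l η : ℝ} (hl : 0 ≤ l)
    (hη : 0 ≤ η) (P : Finset α) (hx : ∀ p ∈ P, x p ≤ η) (hP : l ≤ ∑ p ∈ P, x p) :
    ∃ T ⊆ P, l ≤ ∑ p ∈ T, x p ∧ ∑ p ∈ T, x p ≤ l + η := by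
  induction P using Finset.induction_on with
  | empty => exact ⟨∅, subset_rfl, hP, by simp; linarith⟩
  | insert a P ha ih =>
    by_cases h : l ≤ ∑ p ∈ P, x p
    · obtain ⟨T, hT, h1⟩ := ih (fun p hp => hx p (Finset.mem_insert_of_mem hp)) h
      exact ⟨T, hT.trans (Finset.subset_insert _ _), h1⟩
    · refine ⟨_, subset_rfl, hP, ?_⟩
      rw [Finset.sum_insert ha]
      have := hx a (Finset.mem_insert_self _ _)
      linarith

/-- Splitting off disjoint blocks of weight at least `l`, at a cost of at most `l + η` each. -/
theorem exists_blocks {α ι : Type*} [DecidableEq α] [DecidableEq ι] {x : α → ℝ} {l η : ℝ}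
    (hl : 0 ≤ l) (hη : 0 ≤ η) {P : Finset α} (hx : ∀ p ∈ P, x p ≤ η) (M : Finset ι)
    (hP : M.card * (l + η) ≤ ∑ p ∈ P, x p) :
    ∃ (b : ι → Finset α) (Q : Finset α), Q ⊆ P ∧ (∀ i, b i ⊆ P) ∧
      (∀ i ∈ M, l ≤ ∑ p ∈ b i, x p) ∧ (∀ i j, i ≠ j → Disjoint (b i) (b j)) ∧
      (∀ i, Disjoint (b i) Q) ∧ ∑ p ∈ P, x p ≤ ∑ p ∈ Q, x p + M.card * (l + η) := by
  suffices H : ∃ (b : ι → Finset α) (Q : Finset α), Q ⊆ P ∧ (∀ i, b i ⊆ P) ∧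
      (∀ i ∈ M, l ≤ ∑ p ∈ b i, x p) ∧ (∀ i j, i ≠ j → Disjoint (b i) (b j)) ∧
      (∀ i, Disjoint (b i) Q) ∧ ∑ p ∈ P, x p ≤ ∑ p ∈ Q, x p + M.card * (l + η) ∧
      ∀ i ∉ M, b i = ∅ by
    obtain ⟨b, Q, h1, h2, h3, h4, h5, h6, -⟩ := H
    exact ⟨b, Q, h1, h2, h3, h4, h5, h6⟩
  induction M using Finset.induction_on with
  | empty => exact ⟨fun _ => ∅, P, by simp⟩
  | insert i M hi ih =>
    rw [Finset.card_insert_of_notMem hi] at hP ⊢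
    push_cast at hP ⊢
    obtain ⟨b, Q, h1, h2, h3, h4, h5, h6, h7⟩ := ih (by nlinarith)
    obtain ⟨T, hTQ, hT1, hT2⟩ := exists_subset_sum_mem_Icc hl hη Q (fun p hp => hx p (h1 hp))
      (by nlinarith)
    refine ⟨Function.update b i T, Q \ T, Finset.sdiff_subset.trans h1, fun j => ?_, fun j hj => ?_,
      fun j j' hjj => ?_, fun j => ?_, ?_, fun j hj => ?_⟩
    · rcases eq_or_ne j i with rfl | hji
      · simpa using hTQ.trans h1
      · simpa [hji] using h2 j
    · rcases eq_or_ne j i with rfl | hji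
      · simpa using hT1
      · simpa [hji] using h3 j ((Finset.mem_insert.1 hj).resolve_left hji)
    · rcases eq_or_ne j i with rfl | hji
      · simpa [hjj.symm] using ((h5 j').mono_right hTQ).symm
      · rcases eq_or_ne j' i with rfl | hji'
        · simpa [hjj] using (h5 j).mono_right hTQ
        · simpa [hji, hji'] using h4 j j' hjj
    · rcases eq_or_ne j i with rfl | hji
      · simpa using Finset.disjoint_sdiff
      · simpa [hji] using (h5 j).mono_right Finset.sdiff_subset
    · have := Finset.sum_sdiff (f := x) hTQ
      linarith
    · rw [Finset.mem_insert, not_or] at hj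
      simpa [hj.1] using h7 j hj.2

/-- Choosing at most one prime from each of several disjoint blocks, the set of blocks used being a
member of a union-rigid family, gives an LCM-rigid set of integers. -/
theorem UnionRigid.exists_lcmRigid {ι : Type*} [DecidableEq ι] [Fintype ι] {k : ℕ} (hk : 3 ≤ k)
    {F : Finset (Finset ι)} (hF : UnionRigid k F) {M : Finset ι} (hM : ∀ A ∈ F, A ⊆ M)
    {b : ι → Finset ℕ} (hb : ∀ i j, i ≠ j → Disjoint (b i) (b j))
    (hp : ∀ i, ∀ p ∈ b i, p.Prime) {y : ℕ} (hy1 : 1 ≤ y)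
    (hy : ∀ i, ∀ p ∈ b i, p ≤ y) {l : ℝ} (hl : 0 ≤ l)
    (hlb : ∀ i ∈ M, l ≤ ∑ p ∈ b i, 1 / (p : ℝ)) :
    ∃ 𝒜 : Finset ℕ, LCMRigid k 𝒜 ∧ (∀ a ∈ 𝒜, 0 < a ∧ a ≤ y ^ M.card ∧
      ∀ p, p.Prime → p ∣ a → ∃ i, p ∈ b i) ∧ ∑ A ∈ F, l ^ A.card ≤ ∑ a ∈ 𝒜, 1 / (a : ℝ) := by
  classical
  let G : Finset ι → Finset (ι → ℕ) := fun A => Fintype.piFinset fun i => if i ∈ A then b i else {1}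
  have hG : ∀ A g, g ∈ G A ↔ ∀ i, (i ∈ A → g i ∈ b i) ∧ (i ∉ A → g i = 1) := fun A g => by
    simp only [G, Fintype.mem_piFinset]
    refine forall_congr' fun i => ?_
    by_cases h : i ∈ A <;> simp [h]
  -- the blocks and primes used are read off from the product
  have hdvd : ∀ A g, g ∈ G A → ∀ i, ∀ p ∈ b i, p ∣ ∏ j, g j ↔ i ∈ A ∧ g i = p := by
    intro A g hg i p hpi
    rw [(hp i p hpi).prime.dvd_finsetProd_iff]
    constructor
    · rintro ⟨j, -, hj⟩
      by_cases hjA : j ∈ A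
      · have hgj := ((hG A g).1 hg j).1 hjA
        have he := (Nat.prime_dvd_prime_iff_eq (hp i p hpi) (hp j _ hgj)).1 hj
        have hij : i = j := by
          by_contra hne
          exact Finset.disjoint_left.1 (hb i j hne) hpi (he ▸ hgj)
        subst hij
        exact ⟨hjA, he.symm⟩
      · rw [((hG A g).1 hg j).2 hjA] at hj
        exact absurd (Nat.dvd_one.1 hj) (hp i p hpi).one_lt.ne'
    · rintro ⟨-, h⟩
      exact ⟨i, Finset.mem_univ _, h ▸ dvd_rfl⟩
  have hext : ∀ A A' g g', g ∈ G A → g' ∈ G A' →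
      (∀ i, ∀ p ∈ b i, p ∣ ∏ j, g j ↔ p ∣ ∏ j, g' j) → A = A' ∧ g = g' := by
    intro A A' g g' hg hg' h
    have h1 : ∀ i, i ∈ A → i ∈ A' ∧ g' i = g i := fun i hi => by
      have hgi := ((hG A g).1 hg i).1 hi
      exact (hdvd A' g' hg' i _ hgi).1 ((h i _ hgi).1 ((hdvd A g hg i _ hgi).2 ⟨hi, rfl⟩))
    have h2 : ∀ i, i ∈ A' → i ∈ A := fun i hi => by
      have hgi := ((hG A' g').1 hg' i).1 hi
      exact ((hdvd A g hg i _ hgi).1 ((h i _ hgi).2 ((hdvd A' g' hg' i _ hgi).2 ⟨hi, rfl⟩))).1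
    refine ⟨Finset.ext fun i => ⟨fun hi => (h1 i hi).1, h2 i⟩, funext fun i => ?_⟩
    by_cases hi : i ∈ A
    · exact (h1 i hi).2.symm
    · rw [((hG A g).1 hg i).2 hi, ((hG A' g').1 hg' i).2 fun h => hi (h2 i h)]
  have hinj : Set.InjOn (fun s : (_ : Finset ι) × (ι → ℕ) => ∏ i, s.2 i) (F.sigma G) := by
    rintro ⟨A, g⟩ hA ⟨A', g'⟩ hA' h
    simp only [Finset.coe_sigma, Set.mem_sigma_iff, Finset.mem_coe] at hA hA'
    obtain ⟨h1, h2⟩ := hext A A' g g' hA.2 hA'.2 fun i p _ => by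
      have h : ∏ i, g i = ∏ i, g' i := h
      rw [h]
    rw [h1, h2]
  refine ⟨(F.sigma G).image fun s => ∏ i, s.2 i, ?_, ?_, ?_⟩
  · intro a L ha hL u v
    have ha' : ∀ i, ∃ A g, A ∈ F ∧ g ∈ G A ∧ ∏ j, g j = a i := fun i => by
      obtain ⟨⟨A, g⟩, hs, h⟩ := Finset.mem_image.1 (ha i)
      rw [Finset.mem_sigma] at hs
      exact ⟨A, g, hs.1, hs.2, h⟩
    choose A g hAF hgA hga using ha'
    have hda : ∀ s i, ∀ p ∈ b i, p ∣ a s ↔ i ∈ A s ∧ g s i = p := fun s i p hpi => by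
      rw [← hga s]; exact hdvd _ _ (hgA s) i p hpi
    have hdL : ∀ s t, s ≠ t → ∀ i, ∀ p ∈ b i, p ∣ L ↔ p ∣ a s ∨ p ∣ a t :=
      fun s t hst i p hpi => by
        rw [← hL s t hst]; exact (hp i p hpi).dvd_lcm
    -- The blocks meeting the prime divisors of `L` are the union of any two block sets, so rigidity
    -- of `F` makes all block sets equal.
    have hAA : ∀ s t, A s = A t := hF A (Finset.univ.filter fun i => ∃ p ∈ b i, p ∣ L) hAF
      fun s t hst => by
        ext i
        simp only [Finset.mem_union, Finset.mem_filter, Finset.mem_univ, true_and]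
        constructor
        · rintro (hi | hi)
          · have hgi := ((hG _ _).1 (hgA s) i).1 hi
            exact ⟨_, hgi, (hdL s t hst i _ hgi).2 (Or.inl ((hda s i _ hgi).2 ⟨hi, rfl⟩))⟩
          · have hgi := ((hG _ _).1 (hgA t) i).1 hi
            exact ⟨_, hgi, (hdL s t hst i _ hgi).2 (Or.inr ((hda t i _ hgi).2 ⟨hi, rfl⟩))⟩
        · rintro ⟨p, hpi, hpL⟩
          rcases (hdL s t hst i p hpi).1 hpL with h | h
          · exact Or.inl ((hda s i p hpi).1 h).1
          · exact Or.inr ((hda t i p hpi).1 h).1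
    rcases eq_or_ne u v with rfl | huv
    · rfl
    obtain ⟨w, hwu, hwv⟩ : ∃ w : Fin k, w ≠ u ∧ w ≠ v := by
      have : ((Finset.univ : Finset (Fin k)) \ {u, v}).Nonempty := by
        rw [← Finset.card_pos]
        have h1 := Finset.le_card_sdiff {u, v} (Finset.univ : Finset (Fin k))
        have h2 : ({u, v} : Finset (Fin k)).card ≤ 2 := Finset.card_le_two
        rw [Finset.card_univ, Fintype.card_fin] at h1
        omega
      obtain ⟨w, hw⟩ := this
      simp only [Finset.mem_sdiff, Finset.mem_insert, Finset.mem_singleton, not_or] at hw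
      exact ⟨w, hw.2.1, hw.2.2⟩
    rw [← hga u, ← hga v]
    -- A third index `w` is where `3 ≤ k` enters. If `p` divides `a u` but not `a v`, the pair `v,
    -- w` forces `p ∣ a w`. The prime `q` of `a v` in the same block must divide `a u` or `a w`,
    -- each having only `p` there, so `q = p`.
    have key : ∀ u v, u ≠ v → w ≠ u → w ≠ v → ∀ i, ∀ p ∈ b i, p ∣ a u → p ∣ a v := by
      intro u v huv hwu hwv i p hpi hpu
      by_contra hpv
      have hpw : p ∣ a w := ((hdL w v hwv i p hpi).1
        ((hdL u v huv i p hpi).2 (Or.inl hpu))).resolve_right hpv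
      have hi : i ∈ A v := by rw [hAA v u]; exact ((hda u i p hpi).1 hpu).1
      have hq := ((hG _ _).1 (hgA v) i).1 hi
      have hqv := (hda v i _ hq).2 ⟨hi, rfl⟩
      rcases (hdL u w hwu.symm i _ hq).1 ((hdL u v huv i _ hq).2 (Or.inr hqv)) with h | h
      · have h1 := ((hda u i _ hq).1 h).2
        rw [((hda u i p hpi).1 hpu).2] at h1
        exact hpv (h1 ▸ hqv)
      · have h1 := ((hda w i _ hq).1 h).2
        rw [((hda w i p hpi).1 hpw).2] at h1
        exact hpv (h1 ▸ hqv)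
    rw [(hext _ _ _ _ (hgA u) (hgA v) fun i p hpi => by
      rw [hga u, hga v]
      exact ⟨key u v huv hwu hwv i p hpi, key v u huv.symm hwv hwu i p hpi⟩).2]
  · intro a ha
    obtain ⟨⟨A, g⟩, hs, rfl⟩ := Finset.mem_image.1 ha
    rw [Finset.mem_sigma] at hs
    have hg := (hG A g).1 hs.2
    refine ⟨Finset.prod_pos fun i _ => ?_, ?_, fun p hpp hpa => ?_⟩
    · by_cases hi : i ∈ A
      · exact (hp i _ ((hg i).1 hi)).pos
      · change 0 < g i
        rw [(hg i).2 hi]; exact one_pos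
    · change ∏ i, g i ≤ _
      rw [← Finset.prod_subset (Finset.subset_univ M) fun i _ hi =>
        (hg i).2 fun h => hi (hM A hs.1 h)]
      refine Finset.prod_le_pow_card _ _ _ fun i hi => ?_
      by_cases hiA : i ∈ A
      · exact hy i _ ((hg i).1 hiA)
      · exact ((hg i).2 hiA).trans_le hy1
    · obtain ⟨i, -, hi⟩ := (hpp.prime.dvd_finsetProd_iff _).1 hpa
      by_cases hiA : i ∈ A
      · have := (hg i).1 hiA
        rw [(Nat.prime_dvd_prime_iff_eq hpp (hp i _ this)).1 hi]
        exact ⟨i, this⟩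
      · have h1 : g i = 1 := (hg i).2 hiA
        exact absurd (Nat.dvd_one.1 (h1 ▸ hi)) hpp.one_lt.ne'
  · rw [Finset.sum_image hinj, Finset.sum_sigma]
    refine Finset.sum_le_sum fun A hA => ?_
    have h := Finset.prod_univ_sum (fun i => if i ∈ A then b i else {1})
      (fun (_ : ι) (p : ℕ) => 1 / (p : ℝ))
    calc l ^ A.card = ∏ i ∈ A, l := by rw [Finset.prod_const]
      _ ≤ ∏ i ∈ A, ∑ p ∈ b i, 1 / (p : ℝ) :=
        Finset.prod_le_prod (fun _ _ => hl) fun i hi => hlb i (hM A hA hi)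
      _ = ∏ i, ∑ p ∈ (if i ∈ A then b i else {1}), 1 / (p : ℝ) := by
        rw [← Finset.prod_subset (Finset.subset_univ A) fun i _ hi => by simp [hi]]
        exact Finset.prod_congr rfl fun i hi => by rw [if_pos hi]
      _ = ∑ g ∈ G A, ∏ i, 1 / (g i : ℝ) := h
      _ ≤ _ := le_of_eq (Finset.sum_congr rfl fun g _ => by simp)

/-- Coprimality lets the common lcm determine the lcm of the `A`-parts and that of the `B`-parts, so
rigidity applies to each part. -/
theorem LCMRigid.mul {k : ℕ} {A B : Finset ℕ} (hA : LCMRigid k A) (hB : LCMRigid k B)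
    (hAB : ∀ a ∈ A, ∀ b ∈ B, Nat.Coprime a b) :
    LCMRigid k ((A ×ˢ B).image fun x => x.1 * x.2) := by
  intro c L hc hL u v
  rcases eq_or_ne u v with rfl | huv
  · rfl
  have hc' : ∀ i, ∃ a b, a ∈ A ∧ b ∈ B ∧ a * b = c i := fun i => by
    obtain ⟨⟨a, b⟩, hs, h⟩ := Finset.mem_image.1 (hc i)
    rw [Finset.mem_product] at hs
    exact ⟨a, b, hs.1, hs.2, h⟩
  choose a b ha hb hab using hc'
  have hcop : ∀ i j s t, Nat.Coprime (Nat.lcm (a i) (a j)) (Nat.lcm (b s) (b t)) :=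
    fun i j s t =>
      Nat.Coprime.of_dvd (Nat.lcm_dvd_mul _ _) (Nat.lcm_dvd_mul _ _)
        (Nat.Coprime.mul_left
          (Nat.Coprime.mul_right (hAB _ (ha i) _ (hb s)) (hAB _ (ha i) _ (hb t)))
          (Nat.Coprime.mul_right (hAB _ (ha j) _ (hb s)) (hAB _ (ha j) _ (hb t))))
  have hL1 : ∀ i j, i ≠ j → L ∣ Nat.lcm (a i) (a j) * Nat.lcm (b i) (b j) := fun i j hij => by
    rw [← hL i j hij, ← hab i, ← hab j]
    exact Nat.lcm_dvd (mul_dvd_mul (Nat.dvd_lcm_left _ _) (Nat.dvd_lcm_left _ _))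
      (mul_dvd_mul (Nat.dvd_lcm_right _ _) (Nat.dvd_lcm_right _ _))
  have hLa : ∀ i j, i ≠ j → Nat.lcm (a i) (a j) ∣ L := fun i j hij => by
    rw [← hL i j hij, ← hab i, ← hab j]
    exact Nat.lcm_dvd ((Dvd.intro _ rfl).trans (Nat.dvd_lcm_left _ _))
      ((Dvd.intro _ rfl).trans (Nat.dvd_lcm_right _ _))
  have hLb : ∀ i j, i ≠ j → Nat.lcm (b i) (b j) ∣ L := fun i j hij => by
    rw [← hL i j hij, ← hab i, ← hab j]
    exact Nat.lcm_dvd ((Dvd.intro_left _ rfl).trans (Nat.dvd_lcm_left _ _))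
      ((Dvd.intro_left _ rfl).trans (Nat.dvd_lcm_right _ _))
  have h1 : ∀ i j s t, i ≠ j → s ≠ t → Nat.lcm (a i) (a j) ∣ Nat.lcm (a s) (a t) :=
    fun i j s t hij hst =>
      (hcop i j s t).dvd_of_dvd_mul_right ((hLa i j hij).trans (hL1 s t hst))
  have h2 : ∀ i j s t, i ≠ j → s ≠ t → Nat.lcm (b i) (b j) ∣ Nat.lcm (b s) (b t) :=
    fun i j s t hij hst =>
      (hcop s t i j).symm.dvd_of_dvd_mul_left ((hLb i j hij).trans (hL1 s t hst))
  rw [← hab u, ← hab v,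
    hA a (Nat.lcm (a u) (a v)) ha (fun i j hij =>
      Nat.dvd_antisymm (h1 _ _ _ _ hij huv) (h1 _ _ _ _ huv hij)) u v,
    hB b (Nat.lcm (b u) (b v)) hb (fun i j hij =>
      Nat.dvd_antisymm (h2 _ _ _ _ hij huv) (h2 _ _ _ _ huv hij)) u v]

theorem sum_one_div_image_mul {A B : Finset ℕ} (hA : ∀ a ∈ A, 0 < a)
    (hAB : ∀ a ∈ A, ∀ b ∈ B, Nat.Coprime a b) :
    ∑ c ∈ (A ×ˢ B).image (fun x : ℕ × ℕ => x.1 * x.2), 1 / (c : ℝ) =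
      (∑ a ∈ A, 1 / (a : ℝ)) * ∑ b ∈ B, 1 / (b : ℝ) := by
  rw [Finset.sum_image, Finset.sum_product, Finset.sum_mul_sum]
  · refine Finset.sum_congr rfl fun a _ => Finset.sum_congr rfl fun b _ => ?_
    push_cast
    rw [one_div_mul_one_div]
  · rintro ⟨a, b⟩ h ⟨a', b'⟩ h' hab
    simp only [Finset.coe_product, Set.mem_prod, Finset.mem_coe] at h h'
    have hab : a * b = a' * b' := hab
    have ha : a = a' := Nat.dvd_antisymm
      ((hAB a h.1 b' h'.2).dvd_of_dvd_mul_right (hab ▸ Dvd.intro _ rfl))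
      ((hAB a' h'.1 b h.2).dvd_of_dvd_mul_right (hab ▸ Dvd.intro _ rfl))
    subst ha
    rw [Nat.eq_of_mul_eq_mul_left (hA a h.1) hab]

/-- The same family is used `J` times on disjoint sets of primes; harmonic sums and size bounds
multiply. -/
theorem UnionRigid.exists_lcmRigid_pow {k n : ℕ} (hk : 3 ≤ k) {F : Finset (Finset (Fin n))}
    (hF : UnionRigid k F) {M : Finset (Fin n)} (hM : ∀ A ∈ F, A ⊆ M) {l η w : ℝ} (hl : 0 ≤ l)
    (hη : 0 ≤ η) (hw : 0 ≤ w) (hW : w ^ M.card ≤ ∑ A ∈ F, l ^ A.card) {y : ℕ} (hy : 1 ≤ y)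
    (J : ℕ) (P : Finset ℕ) (hP : ∀ p ∈ P, p.Prime ∧ p ≤ y ∧ 1 / (p : ℝ) ≤ η)
    (hJ : J * (M.card * (l + η)) ≤ ∑ p ∈ P, 1 / (p : ℝ)) :
    ∃ 𝒜 : Finset ℕ, LCMRigid k 𝒜 ∧ (∀ a ∈ 𝒜, 0 < a ∧ a ≤ y ^ (M.card * J) ∧
      ∀ p, p.Prime → p ∣ a → p ∈ P) ∧ w ^ (M.card * J) ≤ ∑ a ∈ 𝒜, 1 / (a : ℝ) := by
  induction J generalizing P with
  | zero =>
    refine ⟨{1}, fun a L ha _ i j => ?_, fun a ha => ?_, by simp⟩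
    · rw [Finset.mem_singleton.1 (ha i), Finset.mem_singleton.1 (ha j)]
    · rw [Finset.mem_singleton.1 ha]
      exact ⟨one_pos, by simp, fun p hp h => absurd (Nat.dvd_one.1 h) hp.one_lt.ne'⟩
  | succ J ih =>
    push_cast at hJ
    have hc : 0 ≤ J * (M.card * (l + η)) := by positivity
    obtain ⟨b, Q, hQP, hbP, hbl, hbb, hbQ, hsum⟩ := exists_blocks (x := fun p : ℕ => 1 / (p : ℝ))
      hl hη (fun p hp => (hP p hp).2.2) M (by linarith)
    obtain ⟨𝒜, hA, hA', hAs⟩ := hF.exists_lcmRigid hk hM hbb (fun i p hp => (hP p (hbP i hp)).1) hy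
      (fun i p hp => (hP p (hbP i hp)).2.1) hl hbl
    obtain ⟨ℬ, hB, hB', hBs⟩ := ih Q (fun p hp => hP p (hQP hp)) (by linarith)
    have hcop : ∀ a ∈ 𝒜, ∀ b ∈ ℬ, Nat.Coprime a b := fun a ha c hc =>
      Nat.coprime_of_dvd fun p hp hpa hpc => by
        obtain ⟨i, hi⟩ := (hA' a ha).2.2 p hp hpa
        exact Finset.disjoint_left.1 (hbQ i) hi ((hB' c hc).2.2 p hp hpc)
    refine ⟨_, hA.mul hB hcop, ?_, ?_⟩
    · intro c hc
      obtain ⟨⟨a, d⟩, had, rfl⟩ := Finset.mem_image.1 hc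
      obtain ⟨ha, hd⟩ := Finset.mem_product.1 had
      obtain ⟨ha0, hay, hap⟩ := hA' a ha
      obtain ⟨hd0, hdy, hdp⟩ := hB' d hd
      refine ⟨Nat.mul_pos ha0 hd0, ?_, fun p hp hpc => ?_⟩
      · rw [Nat.mul_succ, add_comm, pow_add]
        exact Nat.mul_le_mul hay hdy
      · rcases hp.dvd_mul.1 hpc with h | h
        · obtain ⟨i, hi⟩ := hap p hp h
          exact hbP i hi
        · exact hQP (hdp p hp h)
    · rw [sum_one_div_image_mul (fun a ha => (hA' a ha).1) hcop,
        Nat.mul_succ, add_comm, pow_add]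
      exact mul_le_mul (hW.trans hAs) hBs (pow_nonneg hw _)
        (Finset.sum_nonneg fun a _ => by positivity)

/-! ### A Mertens lower bound -/

/-- The Euler product sums `1 / n` over all `(N + 1)`-smooth `n`, which include every `n` from 1 to
`N`. -/
theorem log_le_prod_primesBelow (N : ℕ) :
    Real.log (N + 1 : ℕ) ≤ ∏ p ∈ (N + 1).primesBelow, (1 - 1 / (p : ℝ))⁻¹ := by
  let f : ℕ →* ℝ :=
    { toFun := fun n => 1 / (n : ℝ)
      map_one' := by simp
      map_mul' := fun a b => by push_cast; rw [one_div_mul_one_div] }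
  have hf : ∀ {p : ℕ}, p.Prime → ‖f p‖ < 1 := fun {p} hp => by
    change ‖1 / (p : ℝ)‖ < 1
    have : (1 : ℝ) < p := by exact_mod_cast hp.one_lt
    rw [Real.norm_of_nonneg (by positivity), div_lt_one (by linarith)]
    exact this
  have h := (EulerProduct.summable_and_hasSum_smoothNumbers_prod_primesBelow_geometric hf
    (N + 1)).2
  refine (log_add_one_le_harmonic N).trans ?_
  have hsm : ∀ n ∈ Finset.Icc 1 N, n ∈ (N + 1).smoothNumbers := fun n hn => by
    obtain ⟨h1, h2⟩ := Finset.mem_Icc.1 hn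
    exact Nat.mem_smoothNumbers_of_lt h1 (by omega)
  have hs := sum_le_hasSum ((Finset.Icc 1 N).subtype (· ∈ (N + 1).smoothNumbers))
    (fun n _ => (by change (0 : ℝ) ≤ 1 / ((n : ℕ) : ℝ); positivity)) h
  refine le_trans (le_of_eq ?_) hs
  rw [Finset.sum_subtype_of_mem (fun n => f n) hsm, harmonic_eq_sum_Icc]
  push_cast
  refine Finset.sum_congr rfl fun n _ => ?_
  change _ = 1 / (n : ℝ)
  rw [one_div]

/-- Mertens' lower bound for the sum of the reciprocals of the primes. -/
theorem exists_log_log_sub_le_sum_primes {η : ℝ} (hη : 0 < η) :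
    ∃ C : ℝ, ∀ N : ℕ, 1 ≤ N → Real.log (Real.log (N + 1 : ℕ)) - C ≤
      ∑ p ∈ (N + 1).primesBelow with 1 / ((p : ℕ) : ℝ) ≤ η, 1 / (p : ℝ) := by
  refine ⟨2 * (∑' n : ℕ, 1 / (n : ℝ) ^ 2) + ∑ n ∈ Finset.range ⌈1 / η⌉₊, 1 / (n : ℝ), fun N hN => ?_⟩
  have hp2 : ∀ p ∈ (N + 1).primesBelow, (2 : ℝ) ≤ p := fun p hp => by
    exact_mod_cast (Nat.prime_of_mem_primesBelow hp).two_le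
  have hpos : ∀ p ∈ (N + 1).primesBelow, 0 < 1 - 1 / (p : ℝ) := fun p hp => by
    have h2 := hp2 p hp
    rw [sub_pos, div_lt_one (by linarith)]; linarith
  have h0 : 0 < Real.log (N + 1 : ℕ) := Real.log_pos (by exact_mod_cast (by omega : 1 < N + 1))
  have h1 := Real.log_le_log h0 (log_le_prod_primesBelow N)
  rw [Real.log_prod fun p hp => (inv_pos.2 (hpos p hp)).ne'] at h1
  have h2 : ∀ p ∈ (N + 1).primesBelow,
      Real.log (1 - 1 / (p : ℝ))⁻¹ ≤ 1 / (p : ℝ) + 2 * (1 / (p : ℝ) ^ 2) := fun p hp => by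
    have hp := hp2 p hp
    refine (Real.log_le_sub_one_of_pos (inv_pos.2 (hpos p ‹_›))).trans ?_
    have h3 : (1 - 1 / (p : ℝ))⁻¹ - 1 = 1 / ((p : ℝ) - 1) := by
      have : (p : ℝ) - 1 ≠ 0 := by linarith
      field_simp
      ring
    have h4 : 1 / (p : ℝ) + 2 * (1 / (p : ℝ) ^ 2) = (p + 2) / (p : ℝ) ^ 2 := by
      have : (p : ℝ) ≠ 0 := by linarith
      field_simp
    rw [h3, h4, div_le_div_iff₀ (by linarith) (by positivity)]
    nlinarith
  have h3 := h1.trans (Finset.sum_le_sum h2)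
  rw [Finset.sum_add_distrib, ← Finset.mul_sum] at h3
  have h4 : ∑ p ∈ (N + 1).primesBelow, 1 / (p : ℝ) ^ 2 ≤ ∑' n : ℕ, 1 / (n : ℝ) ^ 2 :=
    (Real.summable_one_div_nat_pow.2 one_lt_two).sum_le_tsum _ fun _ _ => by positivity
  have h5 : ∑ p ∈ (N + 1).primesBelow with ¬ 1 / ((p : ℕ) : ℝ) ≤ η, 1 / (p : ℝ) ≤
      ∑ n ∈ Finset.range ⌈1 / η⌉₊, 1 / (n : ℝ) := by
    refine Finset.sum_le_sum_of_subset_of_nonneg (fun p hp => ?_) fun _ _ _ => by positivity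
    obtain ⟨hp1, hp2'⟩ := Finset.mem_filter.1 hp
    rw [Finset.mem_range, Nat.lt_ceil, lt_div_iff₀ hη]
    rw [not_le, lt_div_iff₀ (by linarith [hp2 p hp1])] at hp2'
    linarith
  have h6 := Finset.sum_filter_add_sum_filter_not (N + 1).primesBelow
    (fun p : ℕ => 1 / (p : ℝ) ≤ η) (fun p : ℕ => 1 / (p : ℝ))
  linarith

/-! ### Consequences of the value of the capacity -/

theorem maxSunflowerFree_le_two_pow {k : ℕ} (hk : 1 ≤ k) (n : ℕ) :
    (maxSunflowerFree k n : ℝ) ≤ 2 ^ n := by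
  obtain ⟨F, -, hF⟩ := (isGreatest_maxSunflowerFree hk n).1
  have h := Finset.card_le_univ F
  rw [hF, Fintype.card_finset, Fintype.card_fin] at h
  exact_mod_cast h

theorem rpow_one_div_le {x c : ℝ} (hx : 0 ≤ x) (hc : 0 ≤ c) {n : ℕ} (hn : n ≠ 0) (h : x ≤ c ^ n) :
    x ^ (1 / (n : ℝ)) ≤ c := by
  have h1 := Real.rpow_le_rpow hx h (by positivity : 0 ≤ 1 / (n : ℝ))
  rwa [one_div, Real.pow_rpow_inv_natCast hc hn, ← one_div] at h1

theorem eventually_maxSunflowerFree_rpow_le_two {k : ℕ} (hk : 1 ≤ k) :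
    ∀ᶠ n : ℕ in atTop, (maxSunflowerFree k n : ℝ) ^ (1 / (n : ℝ)) ≤ 2 := by
  filter_upwards [eventually_ne_atTop 0] with n hn
  exact rpow_one_div_le (Nat.cast_nonneg _) zero_le_two hn (maxSunflowerFree_le_two_pow hk n)

theorem isCoboundedUnder_maxSunflowerFree (k : ℕ) : IsCoboundedUnder (· ≤ ·) atTop
    fun n : ℕ => (maxSunflowerFree k n : ℝ) ^ (1 / (n : ℝ)) :=
  isCoboundedUnder_le_of_le atTop (x := 0) fun _ => Real.rpow_nonneg (Nat.cast_nonneg _) _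

theorem sunflowerCapacity_le_two {k : ℕ} (hk : 1 ≤ k) : sunflowerCapacity k ≤ 2 :=
  limsup_le_of_le (isCoboundedUnder_maxSunflowerFree k) (eventually_maxSunflowerFree_rpow_le_two hk)

/-- Any `r` between the capacity and 2 works for large `n`; `D` absorbs the remaining finitely many
`n`. -/
theorem exists_exponential_bound {k : ℕ} (hk : 1 ≤ k) (h : sunflowerCapacity k < 2) :
    ∃ D r : ℝ, 0 ≤ D ∧ 1 ≤ r ∧ r < 2 ∧ ∀ n, (maxSunflowerFree k n : ℝ) ≤ D * r ^ n := by
  obtain ⟨r, hr, hr2⟩ := exists_between (max_lt h one_lt_two)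
  obtain ⟨hrc, hr1⟩ := max_lt_iff.1 hr
  have hev := eventually_lt_of_limsup_lt hrc
    ⟨2, by simpa using eventually_maxSunflowerFree_rpow_le_two hk⟩
  obtain ⟨n₀, hn₀⟩ := eventually_atTop.1 (hev.and (eventually_ne_atTop 0))
  have hS : 0 ≤ ∑ n ∈ Finset.range n₀, (maxSunflowerFree k n : ℝ) :=
    Finset.sum_nonneg fun _ _ => Nat.cast_nonneg _
  refine ⟨1 + ∑ n ∈ Finset.range n₀, (maxSunflowerFree k n : ℝ), r, by linarith, hr1.le, hr2,
    fun n => ?_⟩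
  have hrn : 1 ≤ r ^ n := one_le_pow₀ hr1.le
  rcases lt_or_ge n n₀ with hn | hn
  · have := Finset.single_le_sum (f := fun n => (maxSunflowerFree k n : ℝ))
      (fun _ _ => Nat.cast_nonneg _) (Finset.mem_range.2 hn)
    nlinarith
  · obtain ⟨h1, h2⟩ := hn₀ n hn
    have h3 := pow_le_pow_left₀ (Real.rpow_nonneg (Nat.cast_nonneg _) _) h1.le n
    rw [one_div, Real.rpow_inv_natCast_pow (Nat.cast_nonneg _) h2] at h3
    nlinarith

theorem exists_unionRigid {k : ℕ} (hk : 1 ≤ k) (h : sunflowerCapacity k = 2) {l w : ℝ}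
    (hl1 : l ≤ 1) (hw0 : 0 ≤ w) (hw : w < 1 + l) :
    ∃ (n : ℕ) (M : Finset (Fin n)) (F : Finset (Finset (Fin n))), M.Nonempty ∧
      UnionRigid k F ∧ (∀ A ∈ F, A ⊆ M) ∧ w ^ M.card ≤ ∑ A ∈ F, l ^ A.card := by
  by_contra! H
  have hle := maxSunflowerFree_le_of_weight_lt hk hl1 H
  have hc0 : 0 ≤ 1 - l + w := by linarith
  -- The gap between `1 - l + w` and `c` absorbs the factor `n + 1`, while `c < 2` contradicts the
  -- capacity.
  obtain ⟨c, hc, hc2⟩ := exists_between (show 1 - l + w < 2 by linarith)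
  have hcpos : 0 < c := hc0.trans_lt hc
  have hev : ∀ᶠ n : ℕ in atTop, (maxSunflowerFree k n : ℝ) ^ (1 / (n : ℝ)) ≤ c := by
    have hq0 : 0 ≤ (1 - l + w) / c := by positivity
    have hq1 : (1 - l + w) / c < 1 := (div_lt_one hcpos).2 hc
    have hlim := (tendsto_self_mul_const_pow_of_lt_one hq0 hq1).add
      (tendsto_pow_atTop_nhds_zero_of_lt_one hq0 hq1)
    rw [add_zero] at hlim
    filter_upwards [hlim.eventually_le_const one_pos, eventually_ne_atTop 0] with n hn hn0
    refine rpow_one_div_le (Nat.cast_nonneg _) hcpos.le hn0 ((hle n).trans ?_)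
    have h1 : (n + 1) * (1 - l + w) ^ n =
        (n * ((1 - l + w) / c) ^ n + ((1 - l + w) / c) ^ n) * c ^ n := by
      rw [div_pow]; field_simp
    rw [h1]
    exact mul_le_of_le_one_left (by positivity) hn
  have := limsup_le_of_le (isCoboundedUnder_maxSunflowerFree k) hev
  change sunflowerCapacity k ≤ c at this
  linarith

/-! ### Choice of parameters and asymptotics -/

theorem tendsto_log_natCast : Tendsto (fun N : ℕ => Real.log N) atTop atTop :=
  Real.tendsto_log_atTop.comp tendsto_natCast_atTop_atTop

theorem tendsto_log_log_natCast : Tendsto (fun N : ℕ => Real.log (Real.log N)) atTop atTop :=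
  Real.tendsto_log_atTop.comp tendsto_log_natCast

theorem rpow_log_eventually_le_maxHarmonicSum {k : ℕ} (hk : 3 ≤ k) (h : sunflowerCapacity k = 2)
    {δ : ℝ} (hδ : 0 < δ) (hδ1 : δ < 1) :
    ∀ᶠ N : ℕ in atTop, Real.log N ^ (1 - 3 * δ) ≤ maxHarmonicSum k N := by
  -- With `w = 1 + l - l ^ 2` and block cost at most `l + l ^ 2`, the gain per unit of prime weight
  -- is `log w / (l + l ^ 2) ≥ 1 - 3 * l = 1 - δ`.
  obtain ⟨l, hl⟩ : ∃ l, l = δ / 3 := ⟨_, rfl⟩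
  have hl0 : 0 < l := by linarith
  have hl1 : l < 1 / 3 := by linarith
  have hw1 : 1 < 1 + l - l ^ 2 := by nlinarith
  obtain ⟨n, M, F, hM, hF, hFM, hW⟩ := exists_unionRigid (by omega) h (l := l)
    (w := 1 + l - l ^ 2) (by linarith) (by linarith) (by nlinarith)
  have hη : 0 < l ^ 2 := by positivity
  obtain ⟨C, hC⟩ := exists_log_log_sub_le_sum_primes hη
  set w := 1 + l - l ^ 2 with hw
  have hlw : (1 - δ) * (l + l ^ 2) ≤ Real.log w := by
    refine le_trans ?_ (Real.one_sub_inv_le_log_of_pos (by linarith))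
    have h1 : 1 - w⁻¹ = (l - l ^ 2) / w := by
      have : w ≠ 0 := by linarith
      field_simp
      rw [hw]; ring
    rw [h1, le_div_iff₀ (by linarith), hw, (by linarith : δ = 3 * l)]
    have : 0 ≤ l ^ 3 * (6 + l - 3 * l ^ 2) := by
      refine mul_nonneg (by positivity) ?_
      nlinarith
    nlinarith
  have hm : (0 : ℝ) < M.card := by exact_mod_cast hM.card_pos
  have hs : 0 < M.card * (l + l ^ 2) := by positivity
  have hX := tendsto_log_log_natCast
  have hexp := ((tendsto_exp_mul_div_rpow_atTop 1 δ hδ).comp hX).eventually_ge_atTop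
    (2 / (l + l ^ 2))
  filter_upwards [hexp, hX.eventually_gt_atTop 0, hX.eventually_ge_atTop (C / (1 - δ)),
    hX.eventually_ge_atTop (-C), tendsto_log_natCast.eventually_gt_atTop 0,
    hX.eventually_ge_atTop (((1 - δ) * C + M.card * Real.log w) / δ), eventually_gt_atTop 0]
    with N h1 hX0 h2 h3 hL h4 hN
  have hNL : Real.exp (Real.log N) = N := Real.exp_log (by exact_mod_cast hN)
  have hLX : Real.exp (Real.log (Real.log N)) = Real.log N := Real.exp_log hL
  set X := Real.log (Real.log N) with hXdef
  -- `T = (log N) ^ (1 - δ)` plays the role of `log y`; the spare factor `(log N) ^ δ` pays for the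
  -- exponent `M.card * J`, of order `log log N`.
  obtain ⟨T, hT⟩ : ∃ T, T = Real.exp ((1 - δ) * X) := ⟨_, rfl⟩
  have hT0 : 0 < T := hT ▸ Real.exp_pos _
  have hTlog : Real.log T = (1 - δ) * X := by rw [hT, Real.log_exp]
  have h1' : 2 * X / (l + l ^ 2) ≤ Real.exp (δ * X) := by
    have h1 : 2 / (l + l ^ 2) ≤ Real.exp (δ * X) / X ^ (1 : ℝ) := h1
    rw [Real.rpow_one, le_div_iff₀ hX0] at h1
    calc _ = 2 / (l + l ^ 2) * X := by ring
      _ ≤ _ := h1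
  rw [div_le_iff₀ (by linarith)] at h2
  rw [div_le_iff₀ hδ] at h4
  have hTC : 0 ≤ Real.log T - C := by rw [hTlog]; linarith
  obtain ⟨y, hy⟩ : ∃ y, y = ⌊Real.exp T⌋₊ := ⟨_, rfl⟩
  have hy1 : 1 ≤ y := by
    rw [hy]; exact Nat.le_floor (by simpa using Real.one_le_exp hT0.le)
  have hyT : (y : ℝ) ≤ Real.exp T := hy ▸ Nat.floor_le (Real.exp_nonneg T)
  have hTy : Real.log T ≤ Real.log (Real.log (y + 1 : ℕ)) := by
    refine Real.log_le_log hT0 ?_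
    rw [Real.le_log_iff_exp_le (by positivity), hy]
    push_cast
    exact (Nat.lt_floor_add_one _).le
  obtain ⟨J, hJ⟩ : ∃ J, J = ⌊(Real.log T - C) / (M.card * (l + l ^ 2))⌋₊ := ⟨_, rfl⟩
  have hJ1 : J * (M.card * (l + l ^ 2)) ≤ Real.log T - C := by
    rw [← le_div_iff₀ hs, hJ]
    exact Nat.floor_le (by positivity)
  have hJ2 : Real.log T - C ≤ (J + 1) * (M.card * (l + l ^ 2)) := by
    rw [← div_le_iff₀ hs, hJ]
    exact (Nat.lt_floor_add_one _).le
  obtain ⟨𝒜, hA, hA', hAs⟩ := hF.exists_lcmRigid_pow hk hFM hl0.le hη.le (by linarith) hW hy1 J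
    ((y + 1).primesBelow.filter fun p => 1 / (p : ℝ) ≤ l ^ 2) (fun p hp => by
      rw [Finset.mem_filter, Nat.mem_primesBelow] at hp
      exact ⟨hp.1.2, by omega, hp.2⟩)
    (hJ1.trans ((sub_le_sub_right hTy C).trans (hC y hy1)))
  have hyN : (y : ℝ) ^ (M.card * J) ≤ N := by
    calc (y : ℝ) ^ (M.card * J) ≤ Real.exp T ^ (M.card * J) :=
          pow_le_pow_left₀ (Nat.cast_nonneg _) hyT _
      _ = Real.exp ((M.card * J : ℕ) * T) := by rw [Real.exp_nat_mul]
      _ ≤ Real.exp (Real.log N) := Real.exp_le_exp.2 ?_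
      _ = N := hNL
    have h5 : (M.card * J : ℝ) ≤ Real.exp (δ * X) := by
      refine le_trans ?_ h1'
      rw [le_div_iff₀ (by positivity)]
      have : 0 ≤ δ * X := by positivity
      linarith
    push_cast
    calc (M.card * J : ℝ) * T ≤ Real.exp (δ * X) * T := mul_le_mul_of_nonneg_right h5 hT0.le
      _ = Real.log N := by rw [hT, ← Real.exp_add, ← hLX]; congr 1; ring
  have hle : ∑ a ∈ 𝒜, (1 : ℝ) / a ≤ maxHarmonicSum k N :=
    (isGreatest_maxHarmonicSum (by omega) N).2 ⟨𝒜, fun a ha => Finset.mem_Icc.2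
      ⟨(hA' a ha).1, (hA' a ha).2.1.trans (by exact_mod_cast hyN)⟩, hA.lcmFree (by omega), rfl⟩
  refine le_trans ?_ (hAs.trans hle)
  rw [Real.rpow_def_of_pos hL, ← Real.exp_log (show 0 < w by linarith), ← Real.exp_nat_mul,
    Real.exp_le_exp]
  change X * (1 - 3 * δ) ≤ _
  push_cast
  have h6 : (1 - δ) * (Real.log T - C) ≤ (M.card * (J + 1)) * Real.log w := by
    calc (1 - δ) * (Real.log T - C) ≤ (1 - δ) * ((J + 1) * (M.card * (l + l ^ 2))) :=
          mul_le_mul_of_nonneg_left hJ2 (by linarith)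
      _ = (M.card * (J + 1)) * ((1 - δ) * (l + l ^ 2)) := by ring
      _ ≤ _ := mul_le_mul_of_nonneg_left hlw (by positivity)
  rw [hTlog] at h6
  -- The exponent is at least `(1 - δ) ^ 2 * X` less a constant, which `h4` bounds by `δ * X`; hence
  -- the loss `3 * δ`.
  have h7 : 0 ≤ δ ^ 2 * X := by positivity
  nlinarith

theorem maxHarmonicSum_le_one_add_log {k : ℕ} (hk : 1 ≤ k) (N : ℕ) :
    maxHarmonicSum k N ≤ 1 + Real.log N := by
  obtain ⟨A, hA, -, hsum⟩ := (isGreatest_maxHarmonicSum hk N).1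
  rw [← hsum]
  refine (Finset.sum_le_sum_of_subset_of_nonneg hA fun _ _ _ => by positivity).trans ?_
  refine le_trans (le_of_eq ?_) (harmonic_le_one_add_log N)
  rw [harmonic_eq_sum_Icc]
  push_cast
  simp

theorem eqLogPowSubLittleO_one {f : ℕ → ℝ} (hupper : ∀ N, f N ≤ 1 + Real.log N)
    (hlower : ∀ δ : ℝ, 0 < δ → δ < 1 → ∀ᶠ N : ℕ in atTop, Real.log N ^ (1 - 3 * δ) ≤ f N) :
    EqLogPowSubLittleO f 1 := by
  have hpos : ∀ᶠ N : ℕ in atTop, 0 < f N := by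
    filter_upwards [hlower (1 / 2) (by norm_num) (by norm_num),
      tendsto_log_natCast.eventually_gt_atTop 0] with N hN hL
    exact (Real.rpow_pos_of_pos hL _).trans_le hN
  refine ⟨fun N => 1 - Real.log (f N) / Real.log (Real.log N), ?_, ?_⟩
  · rw [Metric.tendsto_nhds]
    intro e he
    -- With `e / 6` the loss `3 * δ` is at most `e / 2`; the cap `1 / 2` keeps `δ < 1`.
    have hδ : 0 < min (e / 6) (1 / 2) := by positivity
    filter_upwards [hlower _ hδ ((min_le_right _ _).trans_lt (by norm_num)), hpos,
      tendsto_log_natCast.eventually_gt_atTop 1, tendsto_log_log_natCast.eventually_gt_atTop 0,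
      tendsto_log_log_natCast.eventually_ge_atTop (Real.log 2 / (e / 2))]
      with N h1 hf hL hX h2
    rw [div_le_iff₀ (by positivity)] at h2
    have h3 := Real.log_le_log (Real.rpow_pos_of_pos (by linarith) _) h1
    rw [Real.log_rpow (by linarith)] at h3
    have h4 := Real.log_le_log hf ((hupper N).trans (by linarith : _ ≤ 2 * Real.log N))
    rw [Real.log_mul two_ne_zero (by linarith)] at h4
    have h5 := min_le_left (e / 6) (1 / 2)
    rw [Real.dist_eq, sub_zero, abs_lt]
    constructor
    · rw [neg_lt_sub_iff_lt_add, div_lt_iff₀ hX]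
      nlinarith
    · rw [sub_lt_comm, lt_div_iff₀ hX]
      nlinarith
  · filter_upwards [hpos, tendsto_log_natCast.eventually_gt_atTop 0,
      tendsto_log_log_natCast.eventually_gt_atTop 0] with N hf hL hX
    rw [sub_sub_cancel, Real.rpow_def_of_pos hL, mul_div_cancel₀ _ hX.ne', Real.exp_log hf]

/-- Once `ε N ≤ (1 - c) / 2`, the claimed value is at least `(log N) ^ ((1 + c) / 2)`, which
outgrows `K * (log N) ^ c`. -/
theorem not_eqLogPowSubLittleO_one {f : ℕ → ℝ} {K c : ℝ} (hc : c < 1)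
    (hf : ∀ᶠ N : ℕ in atTop, f N ≤ K * Real.log N ^ c) : ¬ EqLogPowSubLittleO f 1 := by
  rintro ⟨ε, hε, hfε⟩
  have hlim := (tendsto_rpow_atTop (by linarith : 0 < (1 - c) / 2)).comp tendsto_log_natCast
  obtain ⟨N, h1, h2, h3, h4, h5⟩ := (hf.and (hfε.and ((hε.eventually_le_const
    (by linarith : 0 < (1 - c) / 2)).and ((tendsto_log_natCast.eventually_gt_atTop 1).and
    (hlim.eventually_gt_atTop K))))).exists
  have h5 : K < Real.log N ^ ((1 - c) / 2) := h5
  have hc0 : 0 < Real.log N ^ c := Real.rpow_pos_of_pos (by linarith) _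
  have h6 : Real.log N ^ ((1 - c) / 2) * Real.log N ^ c ≤ Real.log N ^ (1 - ε N) := by
    rw [← Real.rpow_add (by linarith)]
    exact Real.rpow_le_rpow_of_exponent_le h4.le (by linarith)
  rw [h2] at h1
  have h7 := mul_lt_mul_of_pos_right h5 hc0
  linarith

end SunflowerLCM

theorem mainTheorem1 (k : ℕ) (hk : 3 ≤ k) :
    SunflowerLCM.sunflowerCapacity k = 2 ↔
      SunflowerLCM.EqLogPowSubLittleO (fun N : ℕ => SunflowerLCM.maxHarmonicSum k N) 1 := by
  have hk1 : 1 ≤ k := by omega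
  constructor
  · intro h
    exact SunflowerLCM.eqLogPowSubLittleO_one (SunflowerLCM.maxHarmonicSum_le_one_add_log hk1)
      fun δ hδ hδ1 => SunflowerLCM.rpow_log_eventually_le_maxHarmonicSum hk h hδ hδ1
  · intro h
    by_contra hne
    obtain ⟨D, r, hD0, hr1, hr2, hD⟩ := SunflowerLCM.exists_exponential_bound hk1
      (lt_of_le_of_ne (SunflowerLCM.sunflowerCapacity_le_two hk1) hne)
    obtain ⟨K, hev⟩ := SunflowerLCM.exists_maxHarmonicSum_le hk1 hD0 hr1 hD
    exact SunflowerLCM.not_eqLogPowSubLittleO_one (by linarith) hev h
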